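/- **Setting.** Let $\Phi(x,t)=\frac{\tanh x}{1+|t|}$ and $\Psi(t)=\tanh t$ for $x,t\in[-\infty,\infty]$ (with $\tanh(\pm\infty)=\pm1$ and $\Phi(\cdot,\pm\infty)=0$). Let $\Pi$ be the set of paths $(f,t_0)$, where $t_0\in[-\infty,\infty]$ is the starting time and $f:[t_0,\infty]\to[-\infty,\infty]$ is such that $t\mapsto\Phi(f(t),t)$ is continuous. Write $\hat f$ for the extension of $f$ to $[-\infty,\infty]$ that equals $f(t_0)$ before $t_0$, and equip $\Pi$ with the metric $$d\big((f_1,t_1),(f_2,t_2)\big)=\Big(\sup_{t}\big|\Phi(\hat f_1(t),t)-\Phi(\hat f_2(t),t)\big|\Big)\vee\big|\Psi(t_1)-\Psi(t_2)\big|$$ (paths at distance $0$ are identified). Let $\mathcal H$ be the space of nonempty compact subsets of $(\Pi,d)$ with the Hausdorff metric $d_{\mathcal H}$; $\Pi$ and $\mathcal H$ carry their Borel $\sigma$-fields. Two paths $(f_1,t_1),(f_2,t_2)$ cross if there are finite times $s,s'\ge t_1\vee t_2$ with $f_1(s)<f_2(s)$ and $f_1(s')>f_2(s')$; an element of $\mathcal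 H$ is noncrossing if no two of its paths cross (paths may touch or coalesce). A Brownian motion started at $y=(x,t)\in\mathbb R^2$ (space coordinate $x$, time coordinate $t$) is a $\Pi$-valued random variable which almost surely has starting time $t$ and equals $x+B(s-t)$ at every time $s\in[t,\infty)$, where $B$ is a standard Brownian motion. **Proposition B.2.** Let $\mathcal D$ be a countable dense subset of $\mathbb R^2$. For $m\in\mathbb N$ let $\mathcal X_m$ be an $\mathcal H$-valued random variable, defined on some probability space $(\Omega_m,\mathbb P_m)$, which is almost surely noncrossing. Suppose that for each $y\in\mathcal D$ there are $\Pi$-valued random variables $\theta^y_m$ on $\Omega_m$ $(m\in\mathbb N)$ with $\theta^y_m\in\mathcal X_m$ almost surely, such that $\theta^y_m$ converges in distribution, as $m\to\infty$, to a Brownian motion $Z_y$ started at $y$. Then the family $\{\mu_m\}_{m\in\mathbb N}$ of the distributions of the $\mathcal X_m$ on $\mathcal H$ is tight: for every $\varepsilon>0$ there is a compact $G\subseteq\mathcal H$ with $\mu_m(G)\ge 1-\varepsilon$ for all $m$. -/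

import Mathlib

open MeasureTheory ProbabilityTheory Filter
open scoped NNReal Topology

noncomputable section

namespace BrownianWeb

/-- The hyperbolic tangent on the extended real line, with `tanh (±∞) = ±1`. -/
def tanhExt (x : EReal) : ℝ :=
  if x = ⊤ then 1 else if x = ⊥ then -1 else Real.tanh x.toReal

/-- The space coordinate `Φ(x, t) = tanh x / (1 + |t|)` of the compactification of the space-time
plane. It is used at finite times only: at `t = ±∞` its value is `0` for every `x`. -/
def Phi (x : EReal) (t : ℝ) : ℝ := tanhExt x / (1 + |t|)

/-- The time coordinate `Ψ(t) = tanh t` of the compactification. -/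
def Psi (t : EReal) : ℝ := tanhExt t

/-- The space `Π` of continuous paths with a starting time. A path `(f, t₀)`, with `t₀ ∈ [-∞, ∞]`
and `f : [t₀, ∞] → [-∞, ∞]` such that `t ↦ Φ(f(t), t)` is continuous, is recorded by `t₀` and by
the extension `f̂` of `f` that is constantly equal to `f(t₀)` before `t₀`, restricted to finite
times. Nothing is lost: `Φ(·, ±∞) = 0`, so the continuity at `t = ±∞` is automatic, and the metric
on paths does not see the values of `f̂` at `t = ±∞` (paths at distance `0` are identified).
For `t₀ = -∞` the extension is unconstrained, and for `t₀ = ∞` it is a constant. -/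
@[ext]
structure SpaceTimePath where
  /-- the starting time -/
  start : EReal
  /-- the extended path at finite times -/
  toFun : ℝ → EReal
  continuous_Phi : Continuous fun t : ℝ => Phi (toFun t) t
  const_before : ∀ s t : ℝ, (s : EReal) ≤ start → (t : EReal) ≤ start → toFun s = toFun t

namespace SpaceTimePath

instance : CoeFun SpaceTimePath fun _ => ℝ → EReal := ⟨toFun⟩

end SpaceTimePath

theorem tanhExt_top : tanhExt ⊤ = 1 := by simp [tanhExt]

theorem tanhExt_bot : tanhExt ⊥ = -1 := by simp [tanhExt]

theorem tanhExt_coe (x : ℝ) : tanhExt x = Real.tanh x := by simp [tanhExt]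

theorem tanhExt_injective : Function.Injective tanhExt := by
  intro x y h
  have h1 := Real.tanh_lt_one
  have h2 := Real.neg_one_lt_tanh
  induction x with
  | bot =>
    induction y with
    | bot => rfl
    | top => rw [tanhExt_top, tanhExt_bot] at h; norm_num at h
    | coe y => rw [tanhExt_bot, tanhExt_coe] at h; linarith [h2 y]
  | top =>
    induction y with
    | bot => rw [tanhExt_top, tanhExt_bot] at h; norm_num at h
    | top => rfl
    | coe y => rw [tanhExt_top, tanhExt_coe] at h; linarith [h1 y]
  | coe x =>
    induction y with
    | bot => rw [tanhExt_bot, tanhExt_coe] at h; linarith [h2 x]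
    | top => rw [tanhExt_top, tanhExt_coe] at h; linarith [h1 x]
    | coe y =>
      rw [tanhExt_coe, tanhExt_coe] at h
      rw [Real.tanh_injective h]

theorem abs_tanhExt_le_one (x : EReal) : |tanhExt x| ≤ 1 := by
  induction x with
  | bot => simp [tanhExt_bot]
  | top => simp [tanhExt_top]
  | coe x => rw [tanhExt_coe]; exact (Real.abs_tanh_lt_one x).le

theorem abs_Phi_le_one (x : EReal) (t : ℝ) : |Phi x t| ≤ 1 := by
  have h : (1 : ℝ) ≤ 1 + |t| := by linarith [abs_nonneg t]
  rw [Phi, abs_div, abs_of_pos (by linarith : (0 : ℝ) < 1 + |t|), div_le_one (by linarith)]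
  exact (abs_tanhExt_le_one x).trans h

theorem Phi_left_injective (t : ℝ) : Function.Injective fun x => Phi x t := by
  intro x y h
  have ht : (1 + |t| : ℝ) ≠ 0 := by positivity
  apply tanhExt_injective
  simpa [Phi, div_left_inj' ht] using h

theorem bddAbove_Phi_sub (p q : SpaceTimePath) :
    BddAbove (Set.range fun t : ℝ => |Phi (p t) t - Phi (q t) t|) := by
  refine ⟨2, ?_⟩
  rintro _ ⟨t, rfl⟩
  have h := abs_sub (Phi (p t) t) (Phi (q t) t)
  have h1 := abs_Phi_le_one (p t) t
  have h2 := abs_Phi_le_one (q t) t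
  show |Phi (p t) t - Phi (q t) t| ≤ 2
  linarith

/-- The metric
`d((f₁, t₁), (f₂, t₂)) = (sup_t |Φ(f̂₁(t), t) - Φ(f̂₂(t), t)|) ∨ |Ψ(t₁) - Ψ(t₂)|` on paths. -/
instance : MetricSpace SpaceTimePath where
  dist p q := max (⨆ t : ℝ, |Phi (p t) t - Phi (q t) t|) |Psi p.start - Psi q.start|
  dist_self p := by simp
  dist_comm p q := by simp only [abs_sub_comm]
  dist_triangle p q r := by
    refine max_le (ciSup_le fun t => ?_) ?_
    · have h := abs_sub_le (Phi (p t) t) (Phi (q t) t) (Phi (r t) t)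
      have h1 := le_ciSup (bddAbove_Phi_sub p q) t
      have h2 := le_ciSup (bddAbove_Phi_sub q r) t
      exact h.trans (add_le_add (h1.trans (le_max_left _ _)) (h2.trans (le_max_left _ _)))
    · exact (abs_sub_le _ (Psi q.start) _).trans
        (add_le_add (le_max_right _ _) (le_max_right _ _))
  eq_of_dist_eq_zero {p q} h := by
    have h1 : (⨆ t : ℝ, |Phi (p t) t - Phi (q t) t|) ≤ 0 := (le_max_left _ _).trans h.le
    have h2 : |Psi p.start - Psi q.start| ≤ 0 := (le_max_right _ _).trans h.le
    have h3 : p.start = q.start :=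
      tanhExt_injective (sub_eq_zero.1 (abs_nonpos_iff.1 h2))
    have h4 : p.toFun = q.toFun := by
      funext t
      have := (le_ciSup (bddAbove_Phi_sub p q) t).trans h1
      exact Phi_left_injective t (sub_eq_zero.1 (abs_nonpos_iff.1 this))
    exact SpaceTimePath.ext h3 h4

instance : MeasurableSpace SpaceTimePath := borel _

instance : BorelSpace SpaceTimePath := ⟨rfl⟩

/-- The space `𝓗` of (nonempty) compact sets of paths, with the Hausdorff metric. -/
abbrev PathCollection := TopologicalSpace.NonemptyCompacts SpaceTimePath

instance : MeasurableSpace PathCollection := borel _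

instance : BorelSpace PathCollection := ⟨rfl⟩

/-- Two paths cross if, at times at which both have started, the first is strictly to the left of
the second at one time and strictly to the right of it at another time. -/
def Cross (p q : SpaceTimePath) : Prop :=
  ∃ s t : ℝ, max p.start q.start ≤ (s : EReal) ∧ max p.start q.start ≤ (t : EReal) ∧
    p s < q s ∧ q t < p t

/-- A collection of paths is noncrossing if no two of its paths cross (they may meet). -/
def IsNoncrossing (K : PathCollection) : Prop :=
  ∀ p ∈ K, ∀ q ∈ K, ¬ Cross p q

/-- The path-valued random variable `Z` is a (standard) Brownian motion started at the space-time
point `y = (x, t)`: almost surely `Z` starts at time `t` and `Z (t + s) = x + B s` for all `s ≥ 0`,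
where `B` is a standard Brownian motion. -/
def IsBrownianFrom {Ω : Type*} [MeasurableSpace Ω] (y : ℝ × ℝ) (Z : Ω → SpaceTimePath)
    (Q : Measure Ω) : Prop :=
  ∃ B : ℝ≥0 → Ω → ℝ, IsBrownianReal B Q ∧
    ∀ᵐ ω ∂Q, (Z ω).start = (y.2 : EReal) ∧
      ∀ s : ℝ≥0, Z ω (y.2 + s) = ((y.1 + B s ω : ℝ) : EReal)

end BrownianWeb

end

/-!
The compact subsets of a compact set `C` of paths form a compact subset of the hyperspace, so it
suffices to find, for every `ε`, a compact `C` that contains all paths of `X m` with probability at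
least `1 - ε`, for all `m`. By Arzelà–Ascoli (`SpaceTimePath.isCompact_iInter_modulusSet`) this
amounts to a bound in probability, uniform in `m`, on the modulus of continuity of `tanh ∘ p` over
all paths `p` of `X m` on each time window `[-n, n]`.

Each `X m` taken alone has a modulus, because it is compact; so only large `m` matter, and for
these the bound comes from the noncrossing property. Cut the window into steps of length `1 / M`,
and near each grid time and each of finitely many positions pick a point `y` of `D`. If the paths
`θ y m` from all these points stay close to their starting positions for three time steps, they
form walls, and a path of `X m` that moved by a fixed amount within one time step would have to
cross one of them (`IsNoncrossing.subset_modulusSet`). The positions depend only on the amount to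
be detected (`exists_finset_walls`), so that the number of walls is linear in `M`.

That a wall stands is an open condition on the path, hence by convergence in distribution it is
asymptotically at least as likely as for the Brownian motion started from `y`. For the latter,
Ottaviani's maximal inequality (`IsBrownianReal.measure_exists_le_lt`) bounds the probability of
failure by `4 * exp (-c * M)`, and a linear number of such terms tends to `0` as `M → ∞`.
-/

/-! ### The maximal inequality for Brownian motion -/

/-- The Gaussian tail bound; it is stated with an upper bound `h` on the variance, since for the
variance `0` itself the exponent would be a division by zero. -/
theorem ProbabilityTheory.IsPreBrownianReal.measure_abs_ge_le {Ω : Type*} [MeasurableSpace Ω] {Q : Measure Ω}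
    {B : ℝ≥0 → Ω → ℝ} (hB : IsPreBrownianReal B Q) {s h : ℝ≥0} (hs : s ≤ h) {x : ℝ}
    (hx : 0 ≤ x) :
    Q {ω | x ≤ |B s ω|} ≤ ENNReal.ofReal (2 * Real.exp (-x ^ 2 / (2 * h))) := by
  have := hB.isGaussianProcess.isProbabilityMeasure
  have key : ∀ C : ℝ≥0 → Ω → ℝ, IsPreBrownianReal C Q →
      Q {ω | x ≤ C s ω} ≤ ENNReal.ofReal (Real.exp (-x ^ 2 / (2 * h))) := by
    intro C hC
    have hsub : HasSubgaussianMGF (C s) h Q :=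
      { integrable_exp_mul := fun t => by
          have h1 := (hC.hasLaw_eval s)
          have h2 := integrable_exp_mul_gaussianReal (μ := 0) (v := s) t
          rw [← h1.map_eq] at h2
          exact h2.comp_aemeasurable h1.aemeasurable
        mgf_le := fun t => by
          rw [mgf_gaussianReal (hC.hasLaw_eval s).map_eq]
          simp only [zero_mul, zero_add]
          gcongr }
    rw [← ENNReal.ofReal_toReal (measure_ne_top Q _)]
    exact ENNReal.ofReal_le_ofReal (hsub.measure_ge_le hx)
  have h1 : {ω | x ≤ |B s ω|} ⊆ {ω | x ≤ B s ω} ∪ {ω | x ≤ (-B) s ω} := by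
    intro ω hω
    simpa [le_abs] using hω
  calc Q {ω | x ≤ |B s ω|} ≤ Q {ω | x ≤ B s ω} + Q {ω | x ≤ (-B) s ω} :=
        (measure_mono h1).trans (measure_union_le _ _)
    _ ≤ _ := by
        rw [two_mul, ENNReal.ofReal_add (by positivity) (by positivity)]
        exact add_le_add (key B hB) (key (-B) hB.neg)

/-- Ottaviani's inequality for Brownian motion, along finitely many times. The first time `t` in
`F` at which `|B|` reaches `2 * x` splits the event; from there on the increment `B h - B t`,
which is independent of the past, is smaller than `x` with probability at least `1 / 2`. -/
theorem ProbabilityTheory.IsPreBrownianReal.measure_exists_mem_finset_le {Ω : Type*} [MeasurableSpace Ω]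
    {Q : Measure Ω} {B : ℝ≥0 → Ω → ℝ} (hB : IsPreBrownianReal B Q) (F : Finset ℝ≥0) (h : ℝ≥0)
    (hF : ∀ t ∈ F, t ≤ h) {x : ℝ} (hx : 0 ≤ x)
    (hsmall : 4 * Real.exp (-x ^ 2 / (2 * h)) ≤ 1) :
    Q {ω | ∃ t ∈ F, 2 * x ≤ |B t ω|} ≤
      ENNReal.ofReal (4 * Real.exp (-x ^ 2 / (2 * h))) := by
  have := hB.isGaussianProcess.isProbabilityMeasure
  set A : ℝ≥0 → Set Ω := fun t => {ω | 2 * x ≤ |B t ω| ∧ ∀ s ∈ F, s < t → |B s ω| < 2 * x}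
  have hdec : {ω | ∃ t ∈ F, 2 * x ≤ |B t ω|} ⊆ ⋃ t ∈ F, A t := by
    rintro ω ⟨t, ht, htx⟩
    obtain ⟨t₀, h0, hmin⟩ := (F.filter fun t => 2 * x ≤ |B t ω|).exists_min_image id
      ⟨t, by simp [ht, htx]⟩
    rw [Finset.mem_filter] at h0
    refine Set.mem_biUnion h0.1 ⟨h0.2, fun s hs hst => ?_⟩
    by_contra! hc
    exact absurd (hmin s (by simp [hs, hc])) (not_le.2 hst)
  have hAm : ∀ t, NullMeasurableSet (A t) Q := by
    intro t
    have h1 : A t = {ω | 2 * x ≤ |B t ω|} ∩ ⋂ s ∈ F.filter (· < t), {ω | |B s ω| < 2 * x} := by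
      ext ω; simp [A]
    rw [h1]
    have hm : ∀ s, AEMeasurable (fun ω => |B s ω|) Q := fun s => (hB.aemeasurable s).abs
    refine (nullMeasurableSet_le aemeasurable_const (hm t)).inter
      (NullMeasurableSet.biInter (Finset.countable_toSet _) fun s _ =>
        nullMeasurableSet_lt (hm s) aemeasurable_const)
  have hdisj : ∀ t ∈ F, ∀ s ∈ F, t ≠ s → Disjoint (A t) (A s) := by
    intro t ht s hs hts
    rw [Set.disjoint_left]
    rintro ω ⟨h1, h2⟩ ⟨h3, h4⟩
    rcases lt_or_gt_of_ne hts with h | h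
    · exact absurd h1 (not_le.2 (h4 t ht h))
    · exact absurd h3 (not_le.2 (h2 s hs h))
  have hind : ∀ t ∈ F, Q (A t) ≤ 2 * Q (A t ∩ {ω | x ≤ |B h ω|}) := by
    intro t ht
    have hth := hF t ht
    have hi := hB.indepFun_shift t
    have hS : MeasurableSet {f : ℝ≥0 → ℝ | |f (h - t)| < x} :=
      measurableSet_lt (by fun_prop) measurable_const
    have hT : MeasurableSet {f : Set.Iic t → ℝ | 2 * x ≤ |f ⟨t, Set.self_mem_Iic⟩| ∧
        ∀ s ∈ F, ∀ hs : s < t, |f ⟨s, hs.le⟩| < 2 * x} := by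
      have hm : MeasurableSet (⋂ s ∈ F, ⋂ hs : s < t,
          {f : Set.Iic t → ℝ | |f ⟨s, hs.le⟩| < 2 * x}) :=
        Finset.measurableSet_biInter _ fun s _ => MeasurableSet.iInter fun hs =>
          measurableSet_lt (measurable_pi_apply _).abs measurable_const
      convert (measurableSet_le (measurable_const (a := 2 * x))
        (measurable_pi_apply (⟨t, Set.self_mem_Iic⟩ : Set.Iic t)).abs).inter hm using 1
      ext; simp
    have h1 := hi.measure_inter_preimage_eq_mul _ _ hS hT
    have h2 : (fun ω (t' : Set.Iic t) ↦ B t' ω) ⁻¹' {f : Set.Iic t → ℝ | 2 * x ≤ |f ⟨t, Set.self_mem_Iic⟩| ∧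
        ∀ s ∈ F, ∀ hs : s < t, |f ⟨s, hs.le⟩| < 2 * x} = A t := by
      ext ω; simp [A]
    have h3 : (fun ω t' ↦ B (t + t') ω - B t ω) ⁻¹' {f : ℝ≥0 → ℝ | |f (h - t)| < x} =
        {ω | |B h ω - B t ω| < x} := by
      ext ω; simp [add_tsub_cancel_of_le hth]
    rw [h2, h3] at h1
    have hsub : {ω | |B h ω - B t ω| < x} ∩ A t ⊆ A t ∩ {ω | x ≤ |B h ω|} := by
      rintro ω ⟨h4, h5⟩
      refine ⟨h5, ?_⟩
      have h6 := h5.1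
      have h7 := abs_sub_abs_le_abs_sub (B t ω) (B h ω)
      rw [abs_sub_comm] at h7
      simp only [Set.mem_ofPred_eq] at h4 ⊢
      linarith
    have hhalf : 1 ≤ 2 * Q {ω | |B h ω - B t ω| < x} := by
      have h4 := (hB.shift t).measure_abs_ge_le (tsub_le_self : h - t ≤ h) hx
      simp only [add_tsub_cancel_of_le hth] at h4
      have h5 : ENNReal.ofReal (2 * Real.exp (-x ^ 2 / (2 * h))) ≤
          ENNReal.ofReal (1 / 2) := by
        apply ENNReal.ofReal_le_ofReal
        linarith
      have h6 : (1 : ENNReal) ≤ Q {ω | |B h ω - B t ω| < x} + Q {ω | x ≤ |B h ω - B t ω|} := by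
        rw [← measure_univ (μ := Q)]
        refine (measure_mono fun ω _ => ?_).trans (measure_union_le _ _)
        exact (lt_or_ge |B h ω - B t ω| x).imp id id
      have h7 := h6.trans (add_le_add_right (h4.trans h5) _)
      by_contra! hlt
      have h8 : Q {ω | |B h ω - B t ω| < x} < ENNReal.ofReal (1 / 2) := by
        rw [← ENNReal.ofReal_toReal (measure_ne_top Q {ω | |B h ω - B t ω| < x})] at hlt ⊢
        rw [← ENNReal.ofReal_ofNat, ← ENNReal.ofReal_mul (by norm_num),
          ENNReal.ofReal_lt_one] at hlt
        exact (ENNReal.ofReal_lt_ofReal_iff (by norm_num)).2 (by linarith)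
      refine absurd h7 (not_le.2 ?_)
      calc _ < ENNReal.ofReal (1 / 2) + ENNReal.ofReal (1 / 2) :=
            ENNReal.add_lt_add_right ENNReal.ofReal_ne_top h8
        _ = 1 := by rw [← ENNReal.ofReal_add (by norm_num) (by norm_num)]; norm_num
    calc Q (A t) ≤ (2 * Q {ω | |B h ω - B t ω| < x}) * Q (A t) := le_mul_of_one_le_left' hhalf
      _ = 2 * Q ({ω | |B h ω - B t ω| < x} ∩ A t) := by rw [h1, mul_assoc]
      _ ≤ _ := by gcongr
  calc Q {ω | ∃ t ∈ F, 2 * x ≤ |B t ω|} ≤ ∑ t ∈ F, Q (A t) :=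
        (measure_mono hdec).trans (measure_biUnion_finset_le _ _)
    _ ≤ ∑ t ∈ F, 2 * Q (A t ∩ {ω | x ≤ |B h ω|}) := Finset.sum_le_sum hind
    _ = 2 * Q (⋃ t ∈ F, A t ∩ {ω | x ≤ |B h ω|}) := by
        rw [← Finset.mul_sum, measure_biUnion_finset₀]
        · intro t ht s hs hts
          exact ((hdisj t ht s hs hts).mono Set.inter_subset_left Set.inter_subset_left).aedisjoint
        · exact fun t _ => (hAm t).inter
            (nullMeasurableSet_le aemeasurable_const (hB.aemeasurable h).abs)
    _ ≤ 2 * Q {ω | x ≤ |B h ω|} := by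
        gcongr
        exact Set.iUnion₂_subset fun t _ => Set.inter_subset_right
    _ ≤ 2 * ENNReal.ofReal (2 * Real.exp (-x ^ 2 / (2 * h))) := by
        gcongr
        exact hB.measure_abs_ge_le le_rfl hx
    _ = _ := by
        rw [← ENNReal.ofReal_ofNat, ← ENNReal.ofReal_mul (by norm_num)]
        congr 1; ring

/-- The maximal inequality for Brownian motion on a time interval. -/
theorem ProbabilityTheory.IsBrownianReal.measure_exists_le_lt {Ω : Type*} [MeasurableSpace Ω]
    {Q : Measure Ω} {B : ℝ≥0 → Ω → ℝ} (hB : IsBrownianReal B Q) (h : ℝ≥0) {x : ℝ} (hx : 0 ≤ x)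
    (hsmall : 4 * Real.exp (-x ^ 2 / (2 * h)) ≤ 1) :
    Q {ω | ∃ t ≤ h, 2 * x < |B t ω|} ≤
      ENNReal.ofReal (4 * Real.exp (-x ^ 2 / (2 * h))) := by
  have : Nonempty (Set.Iic h) := ⟨⟨h, Set.self_mem_Iic⟩⟩
  set d := TopologicalSpace.denseSeq (Set.Iic h)
  set E : ℕ → Set Ω := fun n =>
    {ω | ∃ t ∈ (Finset.range n).image fun i => (d i : ℝ≥0), 2 * x ≤ |B t ω|}
  have hE : Monotone E := by
    rintro n m hnm ω ⟨t, ht, htx⟩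
    refine ⟨t, Finset.image_subset_image (Finset.range_subset_range.2 hnm) ht, htx⟩
  have hsub : {ω | ∃ t ≤ h, 2 * x < |B t ω|} ≤ᵐ[Q] ⋃ n, E n := by
    filter_upwards [hB.cont] with ω hω
    rintro ⟨t, ht, htx⟩
    have hopen : IsOpen {s : Set.Iic h | 2 * x < |B s ω|} :=
      isOpen_lt continuous_const (by fun_prop)
    obtain ⟨i, hi⟩ := (TopologicalSpace.denseRange_denseSeq (Set.Iic h)).exists_mem_open hopen
      ⟨⟨t, ht⟩, htx⟩
    exact Set.mem_iUnion.2 ⟨i + 1, d i, Finset.mem_image_of_mem _ (by simp), le_of_lt hi⟩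
  refine (measure_mono_ae hsub).trans ?_
  rw [hE.measure_iUnion]
  refine iSup_le fun n => hB.measure_exists_mem_finset_le _ h (fun t ht => ?_) hx hsmall
  obtain ⟨i, -, rfl⟩ := Finset.mem_image.1 ht
  exact (d i).2

namespace BrownianWeb

/-! ### The hyperbolic tangent on the extended reals -/

theorem tanhExt_strictMono : StrictMono tanhExt := by
  intro x y h
  have h1 := Real.tanh_lt_one
  have h2 := Real.neg_one_lt_tanh
  induction x with
  | bot =>
    induction y with
    | bot => exact absurd h (lt_irrefl _)
    | top => rw [tanhExt_top, tanhExt_bot]; norm_num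
    | coe y => rw [tanhExt_bot, tanhExt_coe]; exact h2 y
  | top => exact absurd h not_top_lt
  | coe x =>
    induction y with
    | bot => exact absurd h not_lt_bot
    | top => rw [tanhExt_top, tanhExt_coe]; exact h1 x
    | coe y =>
      rw [tanhExt_coe, tanhExt_coe]
      rw [← Real.artanh_lt_artanh_iff ⟨h2 x, h1 x⟩ ⟨h2 y, h1 y⟩, Real.artanh_tanh,
        Real.artanh_tanh]
      exact EReal.coe_lt_coe_iff.1 h

theorem exists_tanhExt_eq {u : ℝ} (hu : u ∈ Set.Icc (-1 : ℝ) 1) : ∃ x, tanhExt x = u := by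
  rcases hu.1.eq_or_lt with rfl | h1
  · exact ⟨⊥, tanhExt_bot⟩
  rcases hu.2.eq_or_lt with rfl | h2
  · exact ⟨⊤, tanhExt_top⟩
  · exact ⟨Real.artanh u, by rw [tanhExt_coe, Real.tanh_artanh ⟨h1, h2⟩]⟩

theorem tanhExt_mem_Icc (x : EReal) : tanhExt x ∈ Set.Icc (-1 : ℝ) 1 :=
  abs_le.1 (abs_tanhExt_le_one x)

/-- Finitely many walls `a ± r` suffice to separate any two positions whose hyperbolic tangents
are at least `η` apart: by compactness of `[-1, 1]²`. -/
theorem exists_finset_walls {η : ℝ} (hη : 0 < η) :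
    ∃ A : Finset ℝ, ∃ r : ℝ, 0 < r ∧ ∀ x y : EReal, η ≤ tanhExt y - tanhExt x →
      ∃ a ∈ A, x < (a - r : ℝ) ∧ (a + r : ℝ) < y := by
  have hK : IsCompact ((Set.Icc (-1 : ℝ) 1 ×ˢ Set.Icc (-1 : ℝ) 1) ∩ {z | η ≤ z.2 - z.1}) :=
    (isCompact_Icc.prod isCompact_Icc).inter_right (isClosed_le (by fun_prop) (by fun_prop))
  have key : ∃ A : Finset ℝ, ∃ r : ℝ, 0 < r ∧ ∀ x y : EReal,
      (tanhExt x, tanhExt y) ∈ (Set.Icc (-1 : ℝ) 1 ×ˢ Set.Icc (-1 : ℝ) 1) ∩ {z | η ≤ z.2 - z.1} →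
      ∃ a ∈ A, x < (a - r : ℝ) ∧ (a + r : ℝ) < y := by
    refine hK.induction_on (p := fun S => ∃ A : Finset ℝ, ∃ r : ℝ, 0 < r ∧ ∀ x y : EReal,
      (tanhExt x, tanhExt y) ∈ S → ∃ a ∈ A, x < (a - r : ℝ) ∧ (a + r : ℝ) < y) ?_ ?_ ?_ ?_
    · exact ⟨∅, 1, one_pos, fun x y h => absurd h (Set.notMem_empty _)⟩
    · rintro S T hST ⟨A, r, hr, h⟩
      exact ⟨A, r, hr, fun x y hxy => h x y (hST hxy)⟩
    · classical
      have hmono : ∀ {r r' a : ℝ} {x y : EReal}, r' ≤ r →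
          x < (a - r : ℝ) ∧ (a + r : ℝ) < y → x < (a - r' : ℝ) ∧ (a + r' : ℝ) < y :=
        fun hr h => ⟨h.1.trans_le (EReal.coe_le_coe_iff.2 (by linarith)),
          (EReal.coe_le_coe_iff.2 (by linarith)).trans_lt h.2⟩
      rintro S T ⟨A, r, hr, h⟩ ⟨A', r', hr', h'⟩
      refine ⟨A ∪ A', min r r', lt_min hr hr', ?_⟩
      rintro x y (hxy | hxy)
      · obtain ⟨a, ha, hxa⟩ := h x y hxy
        exact ⟨a, Finset.mem_union_left _ ha, hmono (min_le_left _ _) hxa⟩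
      · obtain ⟨a, ha, hxa⟩ := h' x y hxy
        exact ⟨a, Finset.mem_union_right _ ha, hmono (min_le_right _ _) hxa⟩
    · rintro ⟨u, v⟩ ⟨⟨hu, hv⟩, huv⟩
      have huv' : η ≤ v - u := huv
      have hu1 : -1 ≤ u := hu.1
      have hv1 : v ≤ 1 := hv.2
      obtain ⟨u', hu', hu''⟩ := exists_between (show u < v by linarith)
      obtain ⟨v', hv', hv''⟩ := exists_between hu''
      have hmu : u' ∈ Set.Ioo (-1 : ℝ) 1 := ⟨by linarith, by linarith⟩
      have hmv : v' ∈ Set.Ioo (-1 : ℝ) 1 := ⟨by linarith, by linarith⟩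
      have hcd : Real.artanh u' < Real.artanh v' := (Real.artanh_lt_artanh_iff hmu hmv).2 hv'
      refine ⟨Set.Iio u' ×ˢ Set.Ioi v', mem_nhdsWithin_of_mem_nhds
        (prod_mem_nhds (Iio_mem_nhds hu') (Ioi_mem_nhds hv'')),
        {(Real.artanh u' + Real.artanh v') / 2}, (Real.artanh v' - Real.artanh u') / 2,
        by linarith, fun x y hxy => ⟨_, Finset.mem_singleton_self _, ?_, ?_⟩⟩
      · rw [← tanhExt_strictMono.lt_iff_lt, tanhExt_coe,
          show (Real.artanh u' + Real.artanh v') / 2 - (Real.artanh v' - Real.artanh u') / 2 =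
            Real.artanh u' by ring, Real.tanh_artanh hmu]
        exact hxy.1
      · rw [← tanhExt_strictMono.lt_iff_lt, tanhExt_coe,
          show (Real.artanh u' + Real.artanh v') / 2 + (Real.artanh v' - Real.artanh u') / 2 =
            Real.artanh v' by ring, Real.tanh_artanh hmv]
        exact hxy.2
  obtain ⟨A, r, hr, h⟩ := key
  exact ⟨A, r, hr, fun x y hxy => h x y ⟨⟨tanhExt_mem_Icc x, tanhExt_mem_Icc y⟩, hxy⟩⟩

/-! ### The path space -/

namespace SpaceTimePath

/-- The position of a path in the compactified space coordinate `tanh`. -/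
noncomputable def height (p : SpaceTimePath) (s : ℝ) : ℝ := tanhExt (p s)

theorem height_eq (p : SpaceTimePath) (s : ℝ) : p.height s = Phi (p s) s * (1 + |s|) := by
  have : (1 + |s| : ℝ) ≠ 0 := by positivity
  rw [height, Phi, div_mul_cancel₀ _ this]

theorem continuous_height (p : SpaceTimePath) : Continuous p.height := by
  have : p.height = fun s => Phi (p s) s * (1 + |s|) := funext p.height_eq
  rw [this]
  exact p.continuous_Phi.mul (by fun_prop)

theorem abs_Psi_sub_le_dist (p q : SpaceTimePath) : |Psi p.start - Psi q.start| ≤ dist p q :=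
  le_max_right _ _

theorem abs_height_sub_le (p q : SpaceTimePath) (s : ℝ) :
    |p.height s - q.height s| ≤ (1 + |s|) * dist p q := by
  have h0 : (0 : ℝ) < 1 + |s| := by positivity
  rw [height_eq, height_eq, ← sub_mul, abs_mul, abs_of_pos h0, mul_comm]
  gcongr
  exact (le_ciSup (bddAbove_Phi_sub p q) s).trans (le_max_left _ _)

theorem continuous_Psi_start : Continuous fun p : SpaceTimePath => Psi p.start :=
  (LipschitzWith.of_dist_le_mul (K := 1) fun p q => by
    simpa [Real.dist_eq] using abs_Psi_sub_le_dist p q).continuous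

theorem continuous_uncurry_height :
    Continuous fun z : SpaceTimePath × ℝ => z.1.height z.2 := by
  rw [continuous_iff_continuousAt]
  rintro ⟨p, s⟩
  rw [ContinuousAt, tendsto_iff_dist_tendsto_zero]
  have h1 : Tendsto (fun z : SpaceTimePath × ℝ =>
      (1 + |z.2|) * dist z.1 p + |p.height z.2 - p.height s|) (𝓝 (p, s)) (𝓝 0) := by
    have h2 : Continuous fun z : SpaceTimePath × ℝ =>
        (1 + |z.2|) * dist z.1 p + |p.height z.2 - p.height s| := by
      have := p.continuous_height
      fun_prop
    simpa using h2.tendsto (p, s)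
  refine squeeze_zero (fun _ => dist_nonneg) (fun z => ?_) h1
  rw [Real.dist_eq]
  calc |z.1.height z.2 - p.height s| ≤ |z.1.height z.2 - p.height z.2|
        + |p.height z.2 - p.height s| := abs_sub_le _ _ _
    _ ≤ _ := by gcongr; exact abs_height_sub_le _ _ _

theorem continuous_height_apply (s : ℝ) : Continuous fun p : SpaceTimePath => p.height s :=
  continuous_uncurry_height.comp (Continuous.prodMk_left s)

/-- The paths whose height varies by at most `1 / (n + 1)` over time spans of length at most `δ`
inside the window `[-n, n]`. -/
def modulusSet (n : ℕ) (δ : ℝ) : Set SpaceTimePath :=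
  {p | ∀ s ∈ Set.Icc (-n : ℝ) n, ∀ t ∈ Set.Icc (-n : ℝ) n, |s - t| ≤ δ →
    |p.height s - p.height t| ≤ 1 / (n + 1)}

theorem modulusSet_anti (n : ℕ) : Antitone (modulusSet n) :=
  fun _ _ h _ hp s hs t ht hst => hp s hs t ht (hst.trans h)

theorem isClosed_modulusSet (n : ℕ) (δ : ℝ) : IsClosed (modulusSet n δ) := by
  simp only [modulusSet, Set.ofPred_forall]
  refine isClosed_iInter fun s => isClosed_iInter fun _ => isClosed_iInter fun t =>
    isClosed_iInter fun _ => isClosed_iInter fun _ => ?_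
  exact isClosed_le ((continuous_height_apply s).sub (continuous_height_apply t)).abs
    continuous_const

/-- The paths of a compact set are uniformly equicontinuous on a bounded window. -/
theorem exists_subset_modulusSet {K : Set SpaceTimePath} (hK : IsCompact K) (n : ℕ) :
    ∃ δ > 0, K ⊆ modulusSet n δ := by
  refine hK.induction_on (p := fun S => ∃ δ > 0, S ⊆ modulusSet n δ)
    ⟨1, one_pos, Set.empty_subset _⟩ ?_ ?_ ?_
  · rintro S T hST ⟨δ, hδ, h⟩
    exact ⟨δ, hδ, hST.trans h⟩
  · rintro S T ⟨δ, hδ, h⟩ ⟨δ', hδ', h'⟩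
    exact ⟨min δ δ', lt_min hδ hδ', Set.union_subset
      (h.trans (modulusSet_anti n (min_le_left _ _)))
      (h'.trans (modulusSet_anti n (min_le_right _ _)))⟩
  · intro p _
    obtain ⟨δ, hδ, h⟩ := Metric.uniformContinuousOn_iff.1
      (isCompact_Icc.uniformContinuousOn_of_continuous
        (p.continuous_height.continuousOn (s := Set.Icc (-n : ℝ) n))) (1 / (n + 1) / 3)
      (by positivity)
    have hr : (0 : ℝ) < 1 / (n + 1) / 3 / (1 + n) := by positivity
    refine ⟨Metric.ball p _, mem_nhdsWithin_of_mem_nhds (Metric.ball_mem_nhds p hr), δ / 2,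
      by positivity, fun q hq s hs t ht hst => ?_⟩
    have hclose : ∀ u ∈ Set.Icc (-n : ℝ) n, |q.height u - p.height u| ≤ 1 / (n + 1) / 3 := by
      intro u hu
      calc |q.height u - p.height u| ≤ (1 + |u|) * dist q p := abs_height_sub_le _ _ _
        _ ≤ (1 + n) * (1 / (n + 1) / 3 / (1 + n)) := by
            gcongr
            · exact abs_le.2 hu
            · exact (Metric.mem_ball.1 hq).le
        _ = _ := by field_simp
    have h1 := hclose s hs
    have h2 := hclose t ht
    have h3 := h s hs t ht (by rw [Real.dist_eq]; linarith)
    rw [Real.dist_eq] at h3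
    rw [abs_le] at h1 h2 ⊢
    rw [abs_lt] at h3
    constructor <;> linarith [h1.1, h1.2, h2.1, h2.2, h3.1, h3.2]

/-- Arzelà–Ascoli for the path space. Far away from the time origin nothing has to be controlled,
because `|Φ(x, t)| ≤ 1 / (1 + |t|)`. -/
theorem isCompact_iInter_modulusSet {δ : ℕ → ℝ} (hδ : ∀ n, 0 < δ n) :
    IsCompact (⋂ n, modulusSet n (δ n)) := by
  rw [isCompact_iff_ultrafilter_le_nhds]
  intro f hf
  have hf' : ∀ n, ∀ᶠ p : SpaceTimePath in f, p ∈ modulusSet n (δ n) := fun n =>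
    mem_of_superset (le_principal_iff.1 hf) (Set.iInter_subset _ n)
  have hlim : ∀ u : SpaceTimePath → ℝ, (∀ p, u p ∈ Set.Icc (-1 : ℝ) 1) →
      ∃ x : EReal, Tendsto u f (𝓝 (tanhExt x)) := by
    intro u hu
    obtain ⟨a, ha, hfa⟩ := (isCompact_Icc (a := (-1 : ℝ)) (b := 1)).ultrafilter_le_nhds (f.map u)
      (le_principal_iff.2 (Filter.mem_map.2 (Filter.univ_mem' hu)))
    obtain ⟨x, rfl⟩ := exists_tanhExt_eq ha
    exact ⟨x, hfa⟩
  choose g hg using fun s : ℝ => hlim (fun p => p.height s) fun p => tanhExt_mem_Icc _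
  obtain ⟨t₀, ht₀⟩ := hlim (fun p => Psi p.start) fun p => tanhExt_mem_Icc _
  have hmod : ∀ n : ℕ, ∀ s ∈ Set.Icc (-n : ℝ) n, ∀ t ∈ Set.Icc (-n : ℝ) n, |s - t| ≤ δ n →
      |tanhExt (g s) - tanhExt (g t)| ≤ 1 / (n + 1) := by
    intro n s hs t ht hst
    exact le_of_tendsto ((hg s).sub (hg t)).abs ((hf' n).mono fun p hp => hp s hs t ht hst)
  have hcont : Continuous fun s => tanhExt (g s) := by
    rw [Metric.continuous_iff]
    intro s ε hε
    obtain ⟨k, hk⟩ := exists_nat_one_div_lt hε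
    obtain ⟨l, hl⟩ := exists_nat_gt (|s| + 1)
    set n := max k l
    have hkn : (k : ℝ) ≤ n := by exact_mod_cast le_max_left k l
    have hln : (l : ℝ) ≤ n := by exact_mod_cast le_max_right k l
    refine ⟨min (δ n) 1, lt_min (hδ n) one_pos, fun t ht => ?_⟩
    rw [Real.dist_eq] at ht ⊢
    have h1 : |t - s| < 1 := ht.trans_le (min_le_right _ _)
    refine (hmod n t ?_ s ?_ (ht.le.trans (min_le_left _ _))).trans_lt (lt_of_le_of_lt ?_ hk)
    · rw [abs_lt] at h1
      have := abs_le.1 (le_refl |s|)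
      constructor <;> linarith
    · have := abs_le.1 (le_refl |s|)
      constructor <;> linarith
    · gcongr
  have hconst : ∀ s t : ℝ, (s : EReal) < t₀ → (t : EReal) < t₀ →
      tanhExt (g s) = tanhExt (g t) := by
    intro s t hs ht
    have h1 : ∀ r : ℝ, (r : EReal) < t₀ → ∀ᶠ p : SpaceTimePath in f, (r : EReal) < p.start := fun r hr =>
      (ht₀.eventually (lt_mem_nhds (tanhExt_strictMono hr))).mono fun p hp =>
        tanhExt_strictMono.lt_iff_lt.1 hp
    refine tendsto_nhds_unique_of_eventuallyEq (hg s) (hg t) ?_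
    filter_upwards [h1 s hs, h1 t ht] with p hps hpt
    rw [height, height, p.const_before s t hps.le hpt.le]
  let q : SpaceTimePath :=
    { start := t₀
      toFun := g
      continuous_Phi := by
        exact hcont.div (by fun_prop) fun t => by positivity
      const_before := by
        -- The limit is constant strictly before `t₀`, hence by continuity up to `t₀`.
        have h2 : ∀ s t : ℝ, s < t → (t : EReal) ≤ t₀ → tanhExt (g s) = tanhExt (g t) := by
          intro s t hst ht
          have h3 : Tendsto (fun r => tanhExt (g r)) (𝓝[<] t) (𝓝 (tanhExt (g t))) :=
            (hcont.tendsto t).mono_left nhdsWithin_le_nhds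
          refine tendsto_nhds_unique_of_eventuallyEq tendsto_const_nhds h3 ?_
          filter_upwards [self_mem_nhdsWithin] with r hr
          exact hconst s r ((EReal.coe_lt_coe_iff.2 hst).trans_le ht)
            ((EReal.coe_lt_coe_iff.2 hr).trans_le ht)
        intro s t hs ht
        apply tanhExt_injective
        rcases lt_trichotomy s t with h | rfl | h
        · exact h2 s t h ht
        · rfl
        · exact (h2 t s h hs).symm }
  have hqmod : ∀ n, q ∈ modulusSet n (δ n) := hmod
  refine ⟨q, Set.mem_iInter.2 hqmod, ?_⟩
  rw [Metric.nhds_basis_ball.ge_iff]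
  intro ε hε
  obtain ⟨n, hn⟩ := exists_nat_one_div_lt (show 0 < ε / 4 by positivity)
  -- A finite net of times of mesh `δ n` in the window controls the whole window.
  obtain ⟨S, hSsub, hSfin, hS⟩ := finite_cover_balls_of_compact
    (isCompact_Icc (a := (-n : ℝ)) (b := n)) (hδ n)
  have hev : ∀ᶠ p : SpaceTimePath in f, ∀ s ∈ S, |p.height s - q.height s| < ε / 4 := by
    refine (Filter.eventually_all_finite hSfin).2 fun s _ => ?_
    have h := (Metric.tendsto_nhds.1 (hg s)) (ε / 4) (by positivity)
    simp only [Real.dist_eq] at h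
    exact h
  have hev₀ : ∀ᶠ p : SpaceTimePath in f, |Psi p.start - Psi q.start| < ε / 4 := by
    have h := (Metric.tendsto_nhds.1 ht₀) (ε / 4) (by positivity)
    simp only [Real.dist_eq] at h
    exact h
  refine Filter.mem_of_superset (hev.and (hev₀.and (hf' n))) ?_
  rintro p ⟨h1, h2, h3⟩
  have hsup : (⨆ t : ℝ, |Phi (p t) t - Phi (q t) t|) ≤ 3 * (ε / 4) := by
    refine ciSup_le fun t => ?_
    have ht0 : (0 : ℝ) < 1 + |t| := by positivity
    have heq : |Phi (p t) t - Phi (q t) t| = |p.height t - q.height t| / (1 + |t|) := by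
      rw [Phi, Phi, ← sub_div, abs_div, abs_of_pos ht0]; rfl
    rw [heq]
    by_cases ht : t ∈ Set.Icc (-n : ℝ) n
    · obtain ⟨s, hs, hts⟩ := Set.mem_iUnion₂.1 (hS ht)
      rw [Metric.mem_ball, Real.dist_eq] at hts
      have h4 := h3 t ht s (hSsub hs) hts.le
      have h5 := hqmod n t ht s (hSsub hs) hts.le
      have h6 := h1 s hs
      refine (div_le_self (abs_nonneg _) (by linarith [abs_nonneg t])).trans ?_
      rw [abs_le] at h4 h5 ⊢
      rw [abs_lt] at h6
      constructor <;> linarith [h4.1, h4.2, h5.1, h5.2, h6.1, h6.2]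
    · have htn : (n : ℝ) ≤ |t| := by
        by_contra! hlt
        exact ht (abs_le.1 hlt.le)
      have hn0 : (0 : ℝ) < n + 1 := by positivity
      have h4 : |p.height t - q.height t| ≤ 2 := by
        have h5 := tanhExt_mem_Icc (p t)
        have h6 := tanhExt_mem_Icc (q t)
        rw [height, height, abs_le]
        constructor <;> linarith [h5.1, h5.2, h6.1, h6.2]
      calc |p.height t - q.height t| / (1 + |t|) ≤ 2 / (1 + n) := by gcongr
        _ = 2 * (1 / (n + 1)) := by rw [add_comm]; ring
        _ ≤ 3 * (ε / 4) := by linarith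
  exact (max_le hsup (h2.le.trans (by linarith))).trans_lt (by linarith : 3 * (ε / 4) < ε)

end SpaceTimePath

/-! ### Walls -/

/-- The paths that have started before time `τ` and stay strictly between `a - r` and `a + r`
during the time interval `[τ, τ']`. -/
def tube (a r τ τ' : ℝ) : Set SpaceTimePath :=
  {p | p.start < (τ : EReal) ∧
    ∀ s ∈ Set.Icc τ τ', ((a - r : ℝ) : EReal) < p s ∧ p s < ((a + r : ℝ) : EReal)}

theorem isOpen_tube (a r τ τ' : ℝ) : IsOpen (tube a r τ τ') := by
  have h1 : IsOpen {p : SpaceTimePath | Psi p.start < tanhExt τ} :=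
    isOpen_lt SpaceTimePath.continuous_Psi_start continuous_const
  have h2 : IsOpen {z : SpaceTimePath × ℝ | tanhExt (a - r : ℝ) < z.1.height z.2 ∧
      z.1.height z.2 < tanhExt (a + r : ℝ)} :=
    (isOpen_lt continuous_const SpaceTimePath.continuous_uncurry_height).inter
      (isOpen_lt SpaceTimePath.continuous_uncurry_height continuous_const)
  have h3 : IsOpen {p : SpaceTimePath | ∀ s ∈ Set.Icc τ τ', tanhExt (a - r : ℝ) < p.height s ∧
      p.height s < tanhExt (a + r : ℝ)} := by
    rw [isOpen_iff_eventually]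
    intro p hp
    exact isCompact_Icc.eventually_forall_of_forall_eventually fun s hs =>
      h2.mem_nhds (hp s hs)
  convert h1.inter h3 using 1
  ext p
  simp only [tube, SpaceTimePath.height, Psi, tanhExt_strictMono.lt_iff_lt, Set.mem_ofPred_eq,
    Set.mem_inter_iff]

/-- A path that moves by more than `1 / (n + 1)` in height within a time `1 / M` has to cross one
of the walls: the wall was started before the move and is still standing at its end. -/
theorem IsNoncrossing.subset_modulusSet {K : PathCollection} (hK : IsNoncrossing K) {n M : ℕ}
    (hM : 0 < M) {A : Finset ℝ} {r : ℝ}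
    (hA : ∀ x y : EReal, 1 / ((n : ℝ) + 1) ≤ tanhExt y - tanhExt x →
      ∃ a ∈ A, x < (a - r : ℝ) ∧ (a + r : ℝ) < y)
    (hwall : ∀ k ∈ Finset.range (2 * n * M + 1), ∀ a ∈ A,
      ∃ q ∈ K, q ∈ tube a r (-n + k / M) (-n + k / M + 2 / M)) :
    (K : Set SpaceTimePath) ⊆ SpaceTimePath.modulusSet n (1 / M) := by
  have hM' : (0 : ℝ) < M := by exact_mod_cast hM
  intro p hp
  have hstart : ∀ s ∈ Set.Icc (-n : ℝ) n, ∀ t ∈ Set.Icc (-n : ℝ) n, p.start ≤ s → s ≤ t →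
      t - s ≤ 1 / M → |p.height s - p.height t| ≤ 1 / (n + 1) := by
    intro s hs t ht hps hst hd
    -- The last wall time `-n + k / M` before `s`.
    set k := ⌊(s + n) * M⌋₊
    have hsn : 0 ≤ s + n := by linarith [hs.1]
    have hk1 : (k : ℝ) ≤ (s + n) * M := Nat.floor_le (by positivity)
    have hk2 : (s + n) * M < k + 1 := Nat.lt_floor_add_one _
    have hk : k ∈ Finset.range (2 * n * M + 1) := by
      rw [Finset.mem_range, Nat.lt_succ_iff]
      have h1 : (k : ℝ) ≤ 2 * n * M := hk1.trans (by gcongr; linarith [hs.2])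
      exact_mod_cast h1
    have hτs : -n + k / M ≤ s := by
      have : k / M ≤ s + n := (div_le_iff₀ hM').2 hk1
      linarith
    have htτ : t ≤ -n + k / M + 2 / M := by
      have h1 : s + n ≤ (k + 1) / M := (le_div_iff₀ hM').2 hk2.le
      have h2 : ((k : ℝ) + 1) / M + 1 / M = k / M + 2 / M := by ring
      linarith
    have hmem_s : s ∈ Set.Icc (-n + k / M : ℝ) (-n + k / M + 2 / M) := ⟨hτs, hst.trans htτ⟩
    have hmem_t : t ∈ Set.Icc (-n + k / M : ℝ) (-n + k / M + 2 / M) := ⟨hτs.trans hst, htτ⟩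
    have hst' : (s : EReal) ≤ t := EReal.coe_le_coe_iff.2 hst
    have hτs' : ((-n + k / M : ℝ) : EReal) ≤ s := EReal.coe_le_coe_iff.2 hτs
    by_contra! hlt
    rcases lt_abs.1 hlt with h | h
    · obtain ⟨a, ha, h1, h2⟩ := hA (p t) (p s) h.le
      obtain ⟨q, hq, hq1, hq2⟩ := hwall k hk a ha
      have hm : max p.start q.start ≤ (s : EReal) := max_le hps (hq1.le.trans hτs')
      exact hK p hp q hq ⟨t, s, hm.trans hst', hm, h1.trans (hq2 t hmem_t).1,
        (hq2 s hmem_s).2.trans h2⟩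
    · obtain ⟨a, ha, h1, h2⟩ := hA (p s) (p t) (by
        rw [neg_sub] at h; exact h.le)
      obtain ⟨q, hq, hq1, hq2⟩ := hwall k hk a ha
      have hm : max p.start q.start ≤ (s : EReal) := max_le hps (hq1.le.trans hτs')
      exact hK p hp q hq ⟨s, t, hm, hm.trans hst', h1.trans (hq2 s hmem_s).1,
        (hq2 t hmem_t).2.trans h2⟩
  have hle : ∀ s ∈ Set.Icc (-n : ℝ) n, ∀ t ∈ Set.Icc (-n : ℝ) n, s ≤ t →
      t - s ≤ 1 / M → |p.height s - p.height t| ≤ 1 / (n + 1) := by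
    intro s hs t ht hst hd
    rcases le_or_gt p.start s with hps | hps
    · exact hstart s hs t ht hps hst hd
    rcases le_or_gt (t : EReal) p.start with hpt | hpt
    · rw [SpaceTimePath.height, SpaceTimePath.height, p.const_before s t hps.le hpt, sub_self,
        abs_zero]
      positivity
    -- The path is constant up to its starting time, so the move may be counted from there.
    · obtain ⟨u, hu⟩ : ∃ u : ℝ, (u : EReal) = p.start :=
        ⟨_, EReal.coe_toReal (ne_top_of_lt hpt) (ne_bot_of_gt hps)⟩
      rw [← hu, EReal.coe_lt_coe_iff] at hps hpt
      have h1 := hstart u ⟨hs.1.trans hps.le, hpt.le.trans ht.2⟩ t ht hu.ge hpt.le (by linarith)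
      rwa [SpaceTimePath.height, p.const_before u s hu.le
        (hu ▸ EReal.coe_le_coe_iff.2 hps.le)] at h1
  intro s hs t ht hst
  rcases le_total s t with h | h
  · exact hle s hs t ht h (by linarith [neg_abs_le (s - t)])
  · rw [abs_sub_comm]
    exact hle t ht s hs h (by linarith [le_abs_self (s - t)])

/-! ### The walls are present with high probability -/

/-- A Brownian motion started just before time `τ` close to `a` is a wall with high
probability. -/
theorem IsBrownianFrom.measure_notMem_tube_le {Ω : Type*} [MeasurableSpace Ω] {Q : Measure Ω}
    {y : ℝ × ℝ} {Z : Ω → SpaceTimePath} (hZ : IsBrownianFrom y Z Q) {a r τ τ' : ℝ} {h : ℝ≥0}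
    (hr : 0 ≤ r) (hya : |y.1 - a| < r / 2) (hyτ : y.2 < τ) (hτ' : τ' - y.2 ≤ h)
    (hsmall : 4 * Real.exp (-(r / 4) ^ 2 / (2 * h)) ≤ 1) :
    Q {ω | Z ω ∉ tube a r τ τ'} ≤
      ENNReal.ofReal (4 * Real.exp (-(r / 4) ^ 2 / (2 * h))) := by
  obtain ⟨B, hB, hZB⟩ := hZ
  refine le_trans (measure_mono_ae ?_) (hB.measure_exists_le_lt h (by positivity) hsmall)
  filter_upwards [hZB] with ω hω hnot
  by_contra hcon
  refine hnot ⟨by rw [hω.1]; exact EReal.coe_lt_coe_iff.2 hyτ, fun s hs => ?_⟩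
  have hs0 : 0 ≤ s - y.2 := by linarith [hs.1]
  obtain ⟨v, hv⟩ : ∃ v : ℝ≥0, (v : ℝ) = s - y.2 := ⟨⟨_, hs0⟩, rfl⟩
  have hB1 : |B v ω| ≤ 2 * (r / 4) := by
    by_contra! hlt
    exact hcon ⟨v, NNReal.coe_le_coe.1 (by linarith [hs.2]), hlt⟩
  have hZs := hω.2 v
  rw [hv, add_sub_cancel] at hZs
  rw [hZs, EReal.coe_lt_coe_iff, EReal.coe_lt_coe_iff]
  rw [abs_le] at hB1
  rw [abs_lt] at hya
  constructor <;> linarith [hB1.1, hB1.2, hya.1, hya.2]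

/-- One half of the portmanteau theorem, for random variables on varying probability spaces. -/
theorem eventually_measure_notMem_lt {E Ω' : Type*} [TopologicalSpace E] [MeasurableSpace E]
    [OpensMeasurableSpace E] [HasOuterApproxClosed E] {Ω : ℕ → Type*}
    [∀ m, MeasurableSpace (Ω m)] {P : ∀ m, Measure (Ω m)} [∀ m, IsProbabilityMeasure (P m)]
    [MeasurableSpace Ω'] {Q : Measure Ω'} [IsProbabilityMeasure Q] {θ : ∀ m, Ω m → E}
    {Z : Ω' → E} (hconv : TendstoInDistribution θ atTop Z P Q) {W : Set E} (hW : IsOpen W)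
    {c : ENNReal} (hc : Q {ω | Z ω ∉ W} < c) :
    ∀ᶠ m in atTop, P m {ω | θ m ω ∉ W} < c := by
  have h1 := ProbabilityMeasure.limsup_measure_closed_le_of_tendsto hconv.tendsto
    hW.isClosed_compl
  have h2 : (Q.map Z) Wᶜ = Q {ω | Z ω ∉ W} :=
    Measure.map_apply_of_aemeasurable hconv.aemeasurable_limit hW.measurableSet.compl
  have h3 : ∀ m, ((P m).map (θ m)) Wᶜ = P m {ω | θ m ω ∉ W} := fun m =>
    Measure.map_apply_of_aemeasurable (hconv.forall_aemeasurable m) hW.measurableSet.compl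
  have h4 := eventually_lt_of_limsup_lt (h1.trans_lt (h2.trans_lt hc))
  exact h4.mono fun m hm => (h3 m).symm.trans_lt hm

theorem tendsto_linear_mul_exp_neg (c d : ℝ) {b : ℝ} (hb : 0 < b) :
    Tendsto (fun M : ℕ => (c * M + d) * Real.exp (-b * M)) atTop (𝓝 0) := by
  have h1 := tendsto_rpow_mul_exp_neg_mul_atTop_nhds_zero 1 b hb
  have h0 := tendsto_rpow_mul_exp_neg_mul_atTop_nhds_zero 0 b hb
  simp only [Real.rpow_one, Real.rpow_zero, one_mul] at h0 h1
  have h2 := ((h1.const_mul c).add (h0.const_mul d)).comp tendsto_natCast_atTop_atTop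
  simp only [mul_zero, add_zero] at h2
  refine h2.congr fun M => ?_
  simp only [Function.comp]
  ring

/-! ### Control of the modulus of continuity in probability -/

section Tightness

variable {D : Set (ℝ × ℝ)} {Ω : ℕ → Type*} [∀ m, MeasurableSpace (Ω m)]
  {P : ∀ m, Measure (Ω m)} [∀ m, IsProbabilityMeasure (P m)] {X : ∀ m, Ω m → PathCollection}

/-- The modulus of continuity of the paths of `X m` is controlled for all large `m`: the number
of walls grows linearly in `M`, and each of them fails with exponentially small probability. -/
theorem exists_eventually_measure_not_subset_modulusSet_le (hDc : D.Countable) (hDd : Dense D)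
    (hnc : ∀ m, ∀ᵐ ω ∂(P m), IsNoncrossing (X m ω))
    (θ : D → ∀ m, Ω m → SpaceTimePath) (hθX : ∀ y m, ∀ᵐ ω ∂(P m), θ y m ω ∈ X m ω)
    {Ω' : D → Type*} [∀ y, MeasurableSpace (Ω' y)]
    (Q : ∀ y, Measure (Ω' y)) [∀ y, IsProbabilityMeasure (Q y)]
    (Z : ∀ y, Ω' y → SpaceTimePath)
    (hZ : ∀ y : D, IsBrownianFrom (y : ℝ × ℝ) (Z y) (Q y))
    (hconv : ∀ y, TendstoInDistribution (θ y) atTop (Z y) P (Q y))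
    (n : ℕ) {ε : ℝ} (hε : 0 < ε) :
    ∃ δ > 0, ∀ᶠ m in atTop,
      P m {ω | ¬ (X m ω : Set SpaceTimePath) ⊆ SpaceTimePath.modulusSet n δ} ≤
        ENNReal.ofReal ε := by
  have := hDc.to_subtype
  obtain ⟨A, r, hr, hA⟩ := exists_finset_walls (η := 1 / ((n : ℝ) + 1)) (by positivity)
  have hb : 0 < (r / 4) ^ 2 / 6 := by positivity
  obtain ⟨M, hM0, hMε, hM1⟩ : ∃ M : ℕ, 0 < M ∧
      (A.card * (10 * n) * M + A.card * 5) * Real.exp (-((r / 4) ^ 2 / 6) * M) < ε ∧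
      (0 * M + 4) * Real.exp (-((r / 4) ^ 2 / 6) * M) < 1 :=
    ((eventually_gt_atTop 0).and
      (((tendsto_linear_mul_exp_neg _ _ hb).eventually (gt_mem_nhds hε)).and
        ((tendsto_linear_mul_exp_neg _ _ hb).eventually (gt_mem_nhds one_pos)))).exists
  have hM' : (0 : ℝ) < M := by exact_mod_cast hM0
  -- A wall stands for at most three time steps `1 / M`, counted from its starting time.
  set e := Real.exp (-((r / 4) ^ 2 / 6) * M) with he
  have hee : Real.exp (-(r / 4) ^ 2 / (2 * (3 / M : ℝ≥0))) = e := by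
    rw [he]; congr 1; push_cast; field_simp; norm_num
  have hy : ∀ (k : ℕ) (a : ℝ), ∃ y : D, |(y : ℝ × ℝ).1 - a| < r / 2 ∧
      (-n + k / M - 1 / M : ℝ) < (y : ℝ × ℝ).2 ∧ (y : ℝ × ℝ).2 < -n + k / M := by
    intro k a
    have hopen : IsOpen (Metric.ball a (r / 2) ×ˢ
        Set.Ioo (-n + k / M - 1 / M : ℝ) (-n + k / M)) := Metric.isOpen_ball.prod isOpen_Ioo
    have hlt : (-n + k / M - 1 / M : ℝ) < -n + k / M := by
      linarith [show (0 : ℝ) < 1 / M by positivity]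
    obtain ⟨u, hu⟩ := Set.nonempty_Ioo.2 hlt
    obtain ⟨y, hyD, hyU⟩ := hDd.exists_mem_open hopen
      ⟨(a, u), Metric.mem_ball_self (by positivity), hu⟩
    have hya : dist y.1 a < r / 2 := hyU.1
    exact ⟨⟨y, hyD⟩, by rwa [Real.dist_eq] at hya, hyU.2.1, hyU.2.2⟩
  choose y hy1 hy2 hy3 using hy
  refine ⟨1 / M, by positivity, ?_⟩
  set I := Finset.range (2 * n * M + 1) ×ˢ A with hI
  have hgood : ∀ᶠ m in atTop, ∀ z ∈ I, P m {ω | θ (y z.1 z.2) m ω ∉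
      tube z.2 r (-n + z.1 / M) (-n + z.1 / M + 2 / M)} < ENNReal.ofReal (5 * e) := by
    refine (Filter.eventually_all_finset I).2 fun z _ => ?_
    refine eventually_measure_notMem_lt (hconv _) (isOpen_tube _ _ _ _) ?_
    have h1 := (hZ (y z.1 z.2)).measure_notMem_tube_le (a := z.2) (r := r)
      (τ := -n + z.1 / M) (τ' := -n + z.1 / M + 2 / M) (h := 3 / M) hr.le (hy1 _ _) (hy3 _ _)
      (by
        push_cast
        have h2 := hy2 z.1 z.2
        have h3 : (2 : ℝ) / M + 1 / M = 3 / M := by ring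
        linarith) (by rw [hee]; linarith)
    rw [hee] at h1
    -- `5 * e` instead of `4 * e` leaves room for the passage to the limit.
    refine h1.trans_lt ((ENNReal.ofReal_lt_ofReal_iff (by positivity)).2 ?_)
    linarith [Real.exp_pos (-((r / 4) ^ 2 / 6) * M)]
  filter_upwards [hgood] with m hm
  have hsub : {ω | ¬ (X m ω : Set SpaceTimePath) ⊆ SpaceTimePath.modulusSet n (1 / M)} ≤ᵐ[P m]
      ⋃ z ∈ I, {ω | θ (y z.1 z.2) m ω ∉ tube z.2 r (-n + z.1 / M) (-n + z.1 / M + 2 / M)} := by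
    filter_upwards [hnc m, ae_all_iff.2 fun y => hθX y m] with ω h1 h2 h3
    by_contra hcon
    refine h3 (h1.subset_modulusSet hM0 hA fun k hk a ha => ⟨θ (y k a) m ω, h2 _, ?_⟩)
    by_contra hnot
    exact hcon (Set.mem_biUnion (show (k, a) ∈ (I : Set (ℕ × ℝ)) from
      Finset.mem_product.2 ⟨hk, ha⟩) hnot)
  calc P m {ω | ¬ (X m ω : Set SpaceTimePath) ⊆ SpaceTimePath.modulusSet n (1 / M)}
      ≤ ∑ z ∈ I, P m {ω | θ (y z.1 z.2) m ω ∉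
          tube z.2 r (-n + z.1 / M) (-n + z.1 / M + 2 / M)} :=
        (measure_mono_ae hsub).trans (measure_biUnion_finset_le _ _)
    _ ≤ ∑ _z ∈ I, ENNReal.ofReal (5 * e) := Finset.sum_le_sum fun z hz => (hm z hz).le
    _ = ENNReal.ofReal (I.card * (5 * e)) := by
        rw [Finset.sum_const, nsmul_eq_mul, ENNReal.ofReal_mul (p := (I.card : ℝ)) (by positivity),
          ENNReal.ofReal_natCast]
    _ ≤ ENNReal.ofReal ε := by
        apply ENNReal.ofReal_le_ofReal
        rw [hI, Finset.card_product, Finset.card_range]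
        push_cast
        linarith

/-- For a single random compact set no control at all is needed: its modulus of continuity tends
to `0` surely, hence in probability. -/
theorem exists_measure_not_subset_modulusSet_le {Ω₀ : Type*} [MeasurableSpace Ω₀]
    {P₀ : Measure Ω₀} [IsProbabilityMeasure P₀] {X₀ : Ω₀ → PathCollection} (hX : Measurable X₀)
    (n : ℕ) {ε : ENNReal} (hε : 0 < ε) :
    ∃ δ > 0, P₀ {ω | ¬ (X₀ ω : Set SpaceTimePath) ⊆ SpaceTimePath.modulusSet n δ} ≤ ε := by
  set S : ℕ → Set Ω₀ := fun k =>
    {ω | ¬ (X₀ ω : Set SpaceTimePath) ⊆ SpaceTimePath.modulusSet n (1 / ((k : ℝ) + 1))}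
  have hanti : Antitone S := fun k l hkl ω hω h => hω
    (h.trans (SpaceTimePath.modulusSet_anti n (by gcongr)))
  have hmeas : ∀ k, MeasurableSet (S k) := fun k =>
    (hX (TopologicalSpace.NonemptyCompacts.isClosed_subsets_of_isClosed
      (SpaceTimePath.isClosed_modulusSet n (1 / ((k : ℝ) + 1)))).measurableSet).compl
  have hempty : ⋂ k, S k = ∅ := by
    refine Set.eq_empty_of_forall_notMem fun ω hω => ?_
    obtain ⟨δ, hδ, h⟩ := SpaceTimePath.exists_subset_modulusSet (X₀ ω).isCompact n
    obtain ⟨k, hk⟩ := exists_nat_one_div_lt hδ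
    exact Set.mem_iInter.1 hω k (h.trans (SpaceTimePath.modulusSet_anti n hk.le))
  have hlim := tendsto_measure_iInter_atTop (μ := P₀) (fun k => (hmeas k).nullMeasurableSet)
    hanti ⟨0, measure_ne_top _ _⟩
  rw [hempty, measure_empty] at hlim
  obtain ⟨k, hk⟩ := (hlim.eventually (gt_mem_nhds hε)).exists
  exact ⟨1 / ((k : ℝ) + 1), by positivity, hk.le⟩

/-- A modulus that works for all large `m` can be decreased to one that works for all `m`. -/
theorem exists_forall_measure_not_subset_modulusSet_le (hX : ∀ m, Measurable (X m)) {n : ℕ}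
    {ε : ENNReal} (hε : 0 < ε)
    (h : ∃ δ > 0, ∀ᶠ m in atTop,
      P m {ω | ¬ (X m ω : Set SpaceTimePath) ⊆ SpaceTimePath.modulusSet n δ} ≤ ε) :
    ∃ δ > 0, ∀ m,
      P m {ω | ¬ (X m ω : Set SpaceTimePath) ⊆ SpaceTimePath.modulusSet n δ} ≤ ε := by
  have hmono : ∀ {m : ℕ} {δ δ' : ℝ}, δ' ≤ δ →
      P m {ω | ¬ (X m ω : Set SpaceTimePath) ⊆ SpaceTimePath.modulusSet n δ} ≤ ε →
      P m {ω | ¬ (X m ω : Set SpaceTimePath) ⊆ SpaceTimePath.modulusSet n δ'} ≤ ε :=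
    fun hd hle => (measure_mono (Set.compl_subset_compl.2 fun _ h =>
      Set.Subset.trans h (SpaceTimePath.modulusSet_anti n hd))).trans hle
  obtain ⟨δ, hδ, hev⟩ := h
  obtain ⟨N, hN⟩ := eventually_atTop.1 hev
  choose δ' hδ' h' using fun m => exists_measure_not_subset_modulusSet_le (hX m) (P₀ := P m) n hε
  have hsmall : ∀ᶠ d in 𝓝[>] (0 : ℝ), d ≤ δ ∧ ∀ m ∈ Finset.range N, d ≤ δ' m := by
    have hle : ∀ {c : ℝ}, 0 < c → ∀ᶠ d in 𝓝[>] (0 : ℝ), d ≤ c := fun hc =>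
      ((gt_mem_nhds hc).filter_mono nhdsWithin_le_nhds).mono fun _ => le_of_lt
    exact (hle hδ).and ((Filter.eventually_all_finset _).2 fun m _ => hle (hδ' m))
  obtain ⟨d, ⟨h1, h2⟩, hd⟩ := (hsmall.and self_mem_nhdsWithin).exists
  refine ⟨d, hd, fun m => ?_⟩
  rcases lt_or_ge m N with hm | hm
  · exact hmono (h2 m (Finset.mem_range.2 hm)) (h' m)
  · exact hmono h1 (hN m hm)

end Tightness

end BrownianWeb

theorem propositionB2
    (D : Set (ℝ × ℝ)) (hDc : D.Countable) (hDd : Dense D)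
    {Ω : ℕ → Type*} [∀ m, MeasurableSpace (Ω m)]
    (P : ∀ m, Measure (Ω m)) [∀ m, IsProbabilityMeasure (P m)]
    (X : ∀ m, Ω m → BrownianWeb.PathCollection) (hX : ∀ m, Measurable (X m))
    (hnc : ∀ m, ∀ᵐ ω ∂(P m), BrownianWeb.IsNoncrossing (X m ω))
    (θ : D → ∀ m, Ω m → BrownianWeb.SpaceTimePath)
    (hθ : ∀ y m, Measurable (θ y m))
    (hθX : ∀ y m, ∀ᵐ ω ∂(P m), θ y m ω ∈ X m ω)
    {Ω' : D → Type*} [∀ y, MeasurableSpace (Ω' y)]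
    (Q : ∀ y, Measure (Ω' y)) [∀ y, IsProbabilityMeasure (Q y)]
    (Z : ∀ y, Ω' y → BrownianWeb.SpaceTimePath)
    (hZ : ∀ y : D, BrownianWeb.IsBrownianFrom (y : ℝ × ℝ) (Z y) (Q y))
    (hconv : ∀ y, TendstoInDistribution (θ y) atTop (Z y) P (Q y)) :
    IsTightMeasureSet (Set.range fun m => (P m).map (X m)) := by
  rw [isTightMeasureSet_iff_exists_isCompact_measure_compl_le]
  intro ε hε
  obtain ⟨ε', hε'pos, hε'sum⟩ := ENNReal.exists_pos_sum_of_countable hε.ne' ℕ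
  have key : ∀ n : ℕ, ∃ δ > 0, ∀ m, P m {ω | ¬ (X m ω : Set BrownianWeb.SpaceTimePath) ⊆
      BrownianWeb.SpaceTimePath.modulusSet n δ} ≤ ε' n := fun n => by
    refine BrownianWeb.exists_forall_measure_not_subset_modulusSet_le hX
      (ENNReal.coe_pos.2 (hε'pos n)) ?_
    have h := BrownianWeb.exists_eventually_measure_not_subset_modulusSet_le hDc hDd hnc θ hθX Q Z
      hZ hconv n (NNReal.coe_pos.2 (hε'pos n))
    rwa [ENNReal.ofReal_coe_nnreal] at h
  choose δ hδ hP using key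
  have hG := TopologicalSpace.NonemptyCompacts.isCompact_subsets_of_isCompact
    (BrownianWeb.SpaceTimePath.isCompact_iInter_modulusSet hδ)
  refine ⟨_, hG, ?_⟩
  rintro _ ⟨m, rfl⟩
  rw [Measure.map_apply (hX m) hG.measurableSet.compl]
  calc _ ≤ P m (⋃ n, {ω | ¬ (X m ω : Set BrownianWeb.SpaceTimePath) ⊆
          BrownianWeb.SpaceTimePath.modulusSet n (δ n)}) := by
        refine measure_mono fun ω hω => ?_
        by_contra hcon
        refine hω (Set.subset_iInter fun n => ?_)
        by_contra hn
        exact hcon (Set.mem_iUnion.2 ⟨n, hn⟩)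
    _ ≤ ∑' n, P m {ω | ¬ (X m ω : Set BrownianWeb.SpaceTimePath) ⊆
          BrownianWeb.SpaceTimePath.modulusSet n (δ n)} := measure_iUnion_le _
    _ ≤ ∑' n, (ε' n : ENNReal) := ENNReal.tsum_le_tsum fun n => hP n m
    _ ≤ ε := hε'sum.le
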